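/- Let $R$ be a commutative ring with unity. \begin{itemize} \item A $GV$-ideal of $R$ is a finitely generated ideal $J$ such that the natural map $R\to \mathrm{Hom}_R(J,R)$ is an isomorphism. An $R$-module $N$ is $GV$-torsion-free if no nonzero element of $N$ is annihilated by a $GV$-ideal; it is a $w$-module if moreover $\mathrm{Ext}^1_R(R/J,N)=0$ for every $GV$-ideal $J$. A maximal $w$-ideal of $R$ is an ideal that is maximal among the proper ideals of $R$ that are $w$-modules; such ideals are prime. \item A sequence $0\to A\to B\to C\to 0$ of $R$-modules is $w$-exact if $0\to A_{\mathfrak p}\to B_{\mathfrak p}\to C_{\mathfrak p}\to 0$ is exact for every maximal $w$-ideal $\mathfrak p$; it is $w$-pure exact if it is $w$-exact and $0\to A\otimes_R N\to B\otimes_R N\to C\otimes_R N\to 0$ is $w$-exact for every $R$-module $N$. An $R$-module $A$ is absolutely $w$-pure if $0\to A\to B\to B/A\to 0$ is $w$-pure exact for every $R$-module $B$ containing $A$ as a submodule. \item An $R$-module $P$ is $w$-FP-projective if $\mathrm{Ext}^1_R(P,A)=0$ for every absolutely $w$-pure $R$-module $A$. \item The $w$-FP-projective dimension $w\text{-}\mathrm{fpd}_R(M)$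 of an $R$-module $M$ is the smallest integer $k\ge 0$ such that $\mathrm{Ext}^{k+1}_R(M,A)=0$ for every absolutely $w$-pure $R$-module $A$, and $\infty$ if there is no such $k$. \end{itemize} Assume that $R$ is coherent (every finitely generated ideal is finitely presented), let $M$ be an $R$-module and let $n\ge 0$ be an integer. Then the following are equivalent: \begin{enumerate} \item $w\text{-}\mathrm{fpd}_R(M)\le n$. \item $\mathrm{Ext}^{n+1}_R(M,A)=0$ for every absolutely $w$-pure $R$-module $A$. \item $\mathrm{Ext}^{n+j}_R(M,A)=0$ for every absolutely $w$-pure $R$-module $A$ and every $j\ge 1$. \item For every exact sequence $0\to P_n\to P_{n-1}\to\cdots\to P_0\to M\to 0$ of $R$-modules with $P_0,\dots,P_{n-1}$ $w$-FP-projective, $P_n$ is $w$-FP-projective. \item For every exact sequence $0\to P_n\to P_{n-1}\to\cdots\to P_0\to M\to 0$ of $R$-modules with $P_0,\dots,P_{n-1}$ projective, $P_n$ is $w$-FP-projective. \item There exists an exact sequence $0\to P_n\to P_{n-1}\to\cdots\to P_0\to M\to 0$ of $R$-modules with $P_0,\dots,P_n$ all $w$-FP-projective. \end{enumerate} (For $n=0$,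 the equivalence of (2) and (3) says that $M$ is $w$-FP-projective if and only if $\mathrm{Ext}^{j}_R(M,A)=0$ for every absolutely $w$-pure $A$ and every $j\ge1$.) -/

import Mathlib

universe u

namespace WFPProj

open CategoryTheory CategoryTheory.Abelian

section Ring

variable (R : Type u) [CommRing R]

/-- A commutative ring is coherent if every finitely generated ideal is finitely presented. -/
def IsCoherentRing : Prop :=
  ∀ I : Ideal R, I.FG → Module.FinitePresentation R I

/-- `Ext_R^i(M, N) = 0`. -/
def ExtVanishes (M N : Type u) [AddCommGroup M] [Module R M] [AddCommGroup N] [Module R N]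
    (i : ℕ) : Prop :=
  Subsingleton (Ext (ModuleCat.of R M) (ModuleCat.of R N) i)

variable {R}

/-- Glaz-Vasconcelos ideals: `J` is finitely generated and the natural map
`R → Hom_R(J, R)`, sending `r` to multiplication by `r`, is an isomorphism. -/
def IsGVIdeal (J : Ideal R) : Prop :=
  J.FG ∧ Function.Bijective (fun r : R => r • (J.subtype : J →ₗ[R] R))

/-- `M` is `GV`-torsion-free: the only element killed by a `GV`-ideal is `0`. -/
def IsGVTorsionFree (R : Type u) [CommRing R] (M : Type u) [AddCommGroup M] [Module R M] : Prop :=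
  ∀ (x : M) (J : Ideal R), IsGVIdeal J → (∀ r ∈ J, r • x = 0) → x = 0

/-- `M` is a `w`-module: it is `GV`-torsion-free and `Ext_R^1(R/J, M) = 0` for all
`GV`-ideals `J`. -/
def IsWModule (R : Type u) [CommRing R] (M : Type u) [AddCommGroup M] [Module R M] : Prop :=
  IsGVTorsionFree R M ∧ ∀ J : Ideal R, IsGVIdeal J → ExtVanishes R (R ⧸ J) M 1

/-- Maximal `w`-ideals: the maximal elements among the proper ideals that are `w`-modules. -/
def IsMaximalWIdeal (p : Ideal R) : Prop :=
  Maximal (fun I : Ideal R => I ≠ ⊤ ∧ IsWModule R I) p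

lemma extVanishes_one_iff (J : Ideal R) (N : Type u) [AddCommGroup N] [Module R N] :
    ExtVanishes R (R ⧸ J) N 1 ↔ ∀ f : J →ₗ[R] N, ∃ h : R →ₗ[R] N, h ∘ₗ J.subtype = f := by
  let S : ShortComplex (ModuleCat.{u} R) :=
    ShortComplex.mk (ModuleCat.ofHom (J.subtype : J →ₗ[R] R)) (ModuleCat.ofHom J.mkQ)
      (by ext x; exact (Submodule.Quotient.mk_eq_zero J).2 x.2)
  have hS : S.ShortExact :=
    { exact := (ShortComplex.ShortExact.moduleCat_exact_iff_function_exact S).2 (by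
        intro x
        simpa [S] using Ideal.Quotient.eq_zero_iff_mem)
      mono_f := (ModuleCat.mono_iff_injective _).2 J.injective_subtype
      epi_g := (ModuleCat.epi_iff_surjective _).2 J.mkQ_surjective }
  have : Projective S.X₂ := ModuleCat.projective_of_free (Module.Basis.singleton Unit R)
  constructor
  · intro hE f
    let x₁ : Ext S.X₁ (ModuleCat.of R N) 0 := Ext.mk₀ (ModuleCat.ofHom f)
    have h0 : hS.extClass.comp x₁ (add_zero 1) = 0 := hE.elim _ _
    obtain ⟨x₂, hx₂⟩ := Ext.contravariant_sequence_exact₁ hS (ModuleCat.of R N) x₁ (add_zero 1) h0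
    obtain ⟨h, rfl⟩ := (Ext.homEquiv₀ (X := S.X₂) (Y := ModuleCat.of R N)).symm.surjective x₂
    refine ⟨h.hom, ?_⟩
    have h1 : S.f ≫ h = ModuleCat.ofHom f := by
      apply (Ext.mk₀_bijective S.X₁ (ModuleCat.of R N)).1
      rw [← Ext.mk₀_comp_mk₀]
      exact hx₂
    exact congrArg ModuleCat.Hom.hom h1
  · intro H
    refine ⟨fun a b => ?_⟩
    suffices key : ∀ x : Ext S.X₃ (ModuleCat.of R N) 1, x = 0 by
      exact (key a).trans (key b).symm
    intro x
    obtain ⟨x₁, rfl⟩ := Ext.contravariant_sequence_exact₃ hS (ModuleCat.of R N) x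
      (Ext.eq_zero_of_projective _) (add_zero 1)
    obtain ⟨f, rfl⟩ := (Ext.homEquiv₀ (X := S.X₁) (Y := ModuleCat.of R N)).symm.surjective x₁
    obtain ⟨h, hh⟩ := H f.hom
    have hf : f = S.f ≫ ModuleCat.ofHom h := by
      ext1
      exact hh.symm
    have : (Ext.homEquiv₀ (X := S.X₁) (Y := ModuleCat.of R N)).symm f =
        (Ext.mk₀ S.f).comp (Ext.mk₀ (ModuleCat.ofHom h)) (add_zero 0) := by
      rw [Ext.mk₀_comp_mk₀, ← hf]; rfl
    rw [this, ShortComplex.ShortExact.extClass_comp_assoc]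

lemma isGVTorsionFree_ideal (I : Ideal R) : IsGVTorsionFree R I := by
  intro x J hJ h
  have : (fun r : R => r • (J.subtype : J →ₗ[R] R)) (x : R) =
      (fun r : R => r • (J.subtype : J →ₗ[R] R)) 0 := by
    ext ⟨r, hr⟩
    have := congrArg Subtype.val (h r hr)
    simpa [mul_comm] using this
  exact Subtype.ext (hJ.2.1 this)

lemma isWModule_ideal_iff (I : Ideal R) :
    IsWModule R I ↔ ∀ J : Ideal R, IsGVIdeal J → ∀ x : R, (∀ r ∈ J, r * x ∈ I) → x ∈ I := by
  constructor
  · intro hI J hJ x hx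
    obtain ⟨h, hh⟩ := (extVanishes_one_iff J I).1 (hI.2 J hJ)
      (LinearMap.codRestrict I (x • (J.subtype : J →ₗ[R] R))
        (fun r => by simpa [mul_comm] using hx r r.2))
    have hx1 : x = (h 1 : R) := by
      apply hJ.2.1
      ext r
      have h1 := congrArg Subtype.val (LinearMap.congr_fun hh r)
      have h2 : h (r : R) = (r : R) • h 1 := by rw [← map_smul]; simp
      simp only [LinearMap.comp_apply, Submodule.subtype_apply, h2] at h1
      simpa [mul_comm] using h1.symm
    rw [hx1]
    exact (h 1).2
  · intro H
    refine ⟨isGVTorsionFree_ideal I, fun J hJ => (extVanishes_one_iff J I).2 fun f => ?_⟩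
    obtain ⟨x, hx⟩ := hJ.2.2 (I.subtype ∘ₗ f)
    have hxf : ∀ r : J, x * (r : R) = (f r : R) := fun r => LinearMap.congr_fun hx r
    have hxI : x ∈ I := H J hJ x fun r hr => by
      rw [mul_comm, hxf ⟨r, hr⟩]; exact (f _).2
    refine ⟨LinearMap.toSpanSingleton R I ⟨x, hxI⟩, ?_⟩
    ext r
    simpa [mul_comm] using hxf r

/-- Maximal `w`-ideals are prime, so that one can localize at them. -/
lemma IsMaximalWIdeal.isPrime {p : Ideal R} (hp : IsMaximalWIdeal p) : p.IsPrime := by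
  have hw := (isWModule_ideal_iff p).1 hp.1.2
  refine Ideal.isPrime_iff.2 ⟨hp.1.1, fun {a b} hab => ?_⟩
  by_contra! hcon
  let q : Ideal R := Submodule.comap (LinearMap.lsmul R R a) p
  have hmem : ∀ x, x ∈ q ↔ a * x ∈ p := fun x => Iff.rfl
  have hq : q ≠ ⊤ ∧ IsWModule R q := by
    refine ⟨fun h => hcon.1 ?_, (isWModule_ideal_iff q).2 fun J hJ x hx => ?_⟩
    · have : (1 : R) ∈ q := h ▸ Submodule.mem_top
      simpa [hmem] using this
    · refine hw J hJ (a * x) fun r hr => ?_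
      have := (hmem _).1 (hx r hr)
      rwa [mul_left_comm] at this
  have hle : p ≤ q := fun x hx => p.mul_mem_left a hx
  exact hcon.2 (hp.2 hq hle hab)

section Modules

variable {A B C : Type u} [AddCommGroup A] [Module R A] [AddCommGroup B] [Module R B]
  [AddCommGroup C] [Module R C]

/-- `0 → A → B → C → 0` is `w`-exact: for every maximal `w`-ideal `p` (which is automatically
prime) the localized sequence `0 → A_p → B_p → C_p → 0` is exact. -/
def IsWExact (f : A →ₗ[R] B) (g : B →ₗ[R] C) : Prop :=
  ∀ (p : Ideal R) [p.IsPrime], IsMaximalWIdeal p →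
    Function.Injective (LocalizedModule.map p.primeCompl f) ∧
    Function.Exact (LocalizedModule.map p.primeCompl f) (LocalizedModule.map p.primeCompl g) ∧
    Function.Surjective (LocalizedModule.map p.primeCompl g)

/-- `0 → A → B → C → 0` is `w`-pure exact: it is `w`-exact and stays so after tensoring with any
module. -/
def IsWPureExact (f : A →ₗ[R] B) (g : B →ₗ[R] C) : Prop :=
  IsWExact f g ∧
    ∀ (M : Type u) [AddCommGroup M] [Module R M], IsWExact (f.rTensor M) (g.rTensor M)

end Modules

/-- `A` is absolutely `w`-pure: whenever `A` is embedded in a module `B`, the sequence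
`0 → A → B → B/A → 0` is `w`-pure exact. -/
def IsAbsolutelyWPure (R : Type u) [CommRing R] (A : Type u) [AddCommGroup A] [Module R A] :
    Prop :=
  ∀ (B : Type u) [AddCommGroup B] [Module R B] (f : A →ₗ[R] B), Function.Injective f →
    IsWPureExact f (LinearMap.range f).mkQ

/-- `M` is `w`-FP-projective: `Ext_R^1(M, A) = 0` for every absolutely `w`-pure `A`. -/
def IsWFPProjective (R : Type u) [CommRing R] (M : Type u) [AddCommGroup M] [Module R M] : Prop :=
  ∀ (A : Type u) [AddCommGroup A] [Module R A], IsAbsolutelyWPure R A → ExtVanishes R M A 1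

/-- The `w`-FP-projective dimension: the smallest `k ≥ 0` such that `Ext_R^{k+1}(M, A) = 0` for
every absolutely `w`-pure `A`, and `∞` (the infimum of the empty set) if there is none. -/
noncomputable def wfpd (R : Type u) [CommRing R] (M : Type u) [AddCommGroup M] [Module R M] : ℕ∞ :=
  sInf ((fun k : ℕ => (k : ℕ∞)) '' {k : ℕ | ∀ (A : Type u) [AddCommGroup A] [Module R A],
    IsAbsolutelyWPure R A → ExtVanishes R M A (k + 1)})

/-- An exact sequence `0 → P_n → ⋯ → P_1 → P_0 → M → 0` of `R`-modules, stored as an exact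
sequence `⋯ → P_1 → P_0 → M → 0` with `P_i = 0` for `i > n`. -/
structure ExactSeq (R : Type u) [CommRing R] (M : Type u) [AddCommGroup M] [Module R M]
    (n : ℕ) where
  P : ℕ → ModuleCat.{u} R
  d : ∀ i, P (i + 1) →ₗ[R] P i
  ε : P 0 →ₗ[R] M
  surjective : Function.Surjective ε
  exact_zero : Function.Exact (d 0) ε
  exact_succ : ∀ i, Function.Exact (d (i + 1)) (d i)
  subsingleton : ∀ i, n < i → Subsingleton (P i)

end Ring

end WFPProj

/-!
Localizing at a maximal `w`-ideal `p` kills an element exactly when some `s ∉ p` annihilates it, so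
absolute `w`-purity of `A` is absolute purity up to `p.primeCompl`, for every `p`. Since purity is
solvability of finite linear systems, this amounts to `Ext¹(F, A)` being `p.primeCompl`-torsion for
every finitely presented `F`; to deduce the torsion from purity, embed `A` in an injective module.

Let `R` be coherent, `E` injective, `0 → A → E → C → 0` exact, and `0 → K → Rⁿ → F → 0` exact with
`F` finitely presented. Then `K` is finitely presented and `Ext¹(F, C) ≅ Ext²(F, A) ≅ Ext¹(K, A)`.
Hence the absolutely `w`-pure modules are closed under cosyzygies, so that the vanishing of
`Ext^i(M, -)` on them propagates to larger `i`, and the six conditions follow by dimension shifting.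
-/

namespace WFPProj

open CategoryTheory CategoryTheory.Abelian TensorProduct

section Coherent

variable {R M N : Type*} [CommRing R] [AddCommGroup M] [Module R M] [AddCommGroup N] [Module R N]

/-- Pseudo-coherent modules in the sense of Bourbaki: every finitely generated submodule is
finitely presented, but the module itself need not be finitely generated. A ring is coherent if it
is pseudo-coherent as a module over itself. -/
def IsPseudoCoherent (R M : Type*) [CommRing R] [AddCommGroup M] [Module R M] : Prop :=
  ∀ K : Submodule R M, K.FG → Module.FinitePresentation R K

lemma IsPseudoCoherent.finitePresentation_of_injective [Module.Finite R M]
    (hN : IsPseudoCoherent R N) (f : M →ₗ[R] N) (hf : Function.Injective f) :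
    Module.FinitePresentation R M := by
  have := hN (LinearMap.range f) (Module.Finite.iff_fg.1 inferInstance)
  exact .of_equiv (LinearEquiv.ofInjective f hf).symm

lemma IsPseudoCoherent.of_ker (f : M →ₗ[R] N) (hker : IsPseudoCoherent R (LinearMap.ker f))
    (hN : IsPseudoCoherent R N) : IsPseudoCoherent R M := by
  intro K hK
  have : Module.Finite R K := Module.Finite.iff_fg.2 hK
  let g : K →ₗ[R] LinearMap.range (f ∘ₗ K.subtype) := (f ∘ₗ K.subtype).rangeRestrict
  have hg : Function.Surjective g := LinearMap.surjective_rangeRestrict _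
  have := hN (LinearMap.range (f ∘ₗ K.subtype)) (Module.Finite.iff_fg.1 inferInstance)
  have : Module.Finite R (LinearMap.ker g) :=
    Module.Finite.iff_fg.2 (Module.FinitePresentation.fg_ker g hg)
  let j : LinearMap.ker g →ₗ[R] LinearMap.ker f :=
    K.subtype.restrict fun x hx => congrArg Subtype.val (LinearMap.mem_ker.1 hx)
  have hj : Function.Injective j := fun x y hxy =>
    Subtype.ext (Subtype.ext (congrArg (fun z : LinearMap.ker f => (z : M)) hxy))
  have := hker.finitePresentation_of_injective j hj
  exact Module.finitePresentation_of_ker g hg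

lemma IsPseudoCoherent.of_injective (hN : IsPseudoCoherent R N) (f : M →ₗ[R] N)
    (hf : Function.Injective f) : IsPseudoCoherent R M := fun K hK =>
  have : Module.Finite R K := Module.Finite.iff_fg.2 hK
  hN.finitePresentation_of_injective (f ∘ₗ K.subtype) (hf.comp K.injective_subtype)

lemma IsPseudoCoherent.fin_pi (hM : IsPseudoCoherent R M) :
    ∀ n : ℕ, IsPseudoCoherent R (Fin n → M)
  | 0 => fun K _ => Module.finitePresentation_of_projective R K
  | n + 1 => by
    refine .of_ker (LinearMap.proj 0) ?_ hM
    refine (hM.fin_pi n).of_injective (LinearMap.funLeft R M Fin.succ ∘ₗ Submodule.subtype _) ?_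
    intro x y hxy
    refine Subtype.ext (funext (Fin.cases ?_ (congrFun hxy)))
    exact (LinearMap.mem_ker.1 x.2).trans (LinearMap.mem_ker.1 y.2).symm

end Coherent

section Purity

lemma localizedModule_mk_eq_zero_iff {R M : Type*} [CommRing R] [AddCommGroup M] [Module R M]
    {S : Submonoid R} {x : M} {t : S} : LocalizedModule.mk x t = 0 ↔ ∃ s ∈ S, s • x = 0 := by
  rw [IsLocalizedModule.mk_eq_mk', IsLocalizedModule.mk'_eq_zero']
  simp [Submonoid.smul_def]

variable {R : Type u} [CommRing R] {A B : Type*} [AddCommGroup A] [Module R A] [AddCommGroup B]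
  [Module R B] {S : Submonoid R} {f : A →ₗ[R] B}

lemma localizedModule_map_injective_iff :
    Function.Injective (LocalizedModule.map S f) ↔ ∀ x, f x = 0 → ∃ s ∈ S, s • x = 0 := by
  rw [injective_iff_map_eq_zero]
  constructor
  · intro h x hx
    refine localizedModule_mk_eq_zero_iff (t := 1).1 (h _ ?_)
    rw [LocalizedModule.map_mk, hx, LocalizedModule.zero_mk]
  · intro h z hz
    induction z with
    | _ x t =>
      rw [LocalizedModule.map_mk, localizedModule_mk_eq_zero_iff] at hz
      obtain ⟨s, hs, hsx⟩ := hz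
      obtain ⟨s', hs', hx⟩ := h (s • x) (by rw [map_smul, hsx])
      exact localizedModule_mk_eq_zero_iff.2 ⟨s' * s, mul_mem hs' hs, by rw [mul_smul, hx]⟩

/-- A linear map `f : A → B` is pure up to `S` if every element of the kernel of
`N ⊗ A → N ⊗ B` is killed by some `s ∈ S`, for every module `N`; for `S = {1}` this is purity. -/
def IsPureUpTo (S : Submonoid R) (f : A →ₗ[R] B) : Prop :=
  ∀ (N : Type u) [AddCommGroup N] [Module R N] (x : N ⊗[R] A),
    f.lTensor N x = 0 → ∃ s ∈ S, s • x = 0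

lemma isPureUpTo_of_forall_finite
    (h : ∀ (N : Type u) [AddCommGroup N] [Module R N] [Module.Finite R N] (x : N ⊗[R] A),
      f.lTensor N x = 0 → ∃ s ∈ S, s • x = 0) : IsPureUpTo S f := by
  intro N _ _ x hx
  obtain ⟨N₁, hN₁, x₁, rfl⟩ := Submodule.exists_fg_le_eq_rTensor_subtype x
  have h₁ : N₁.subtype.rTensor B (f.lTensor N₁ x₁) = N₁.subtype.rTensor B 0 := by
    rw [map_zero, ← hx, ← LinearMap.comp_apply, ← LinearMap.comp_apply,
      LinearMap.rTensor_comp_lTensor, LinearMap.lTensor_comp_rTensor]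
  obtain ⟨N₂, hN₂, hle, h₂⟩ := hN₁.exists_rTensor_fg_inclusion_eq h₁
  have : Module.Finite R N₂ := Module.Finite.iff_fg.2 hN₂
  have hx₂ : f.lTensor N₂ ((N₁.inclusion hle).rTensor A x₁) = 0 := by
    rw [← map_zero ((N₁.inclusion hle).rTensor B), ← h₂, ← LinearMap.comp_apply,
      ← LinearMap.comp_apply, LinearMap.rTensor_comp_lTensor, LinearMap.lTensor_comp_rTensor]
  obtain ⟨s, hs, hsx⟩ := h N₂ _ hx₂
  refine ⟨s, hs, ?_⟩
  rw [← N₁.subtype_comp_inclusion N₂ hle, LinearMap.rTensor_comp_apply, ← map_smul, hsx, map_zero]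

lemma sum_single_tmul_bijective {ι : Type*} [Fintype ι] [DecidableEq ι] :
    Function.Bijective fun x : ι → A => ∑ i, (Pi.single i 1 : ι → R) ⊗ₜ[R] x i := by
  let e : (ι → R) ⊗[R] A ≃ₗ[R] (ι → A) :=
    TensorProduct.comm R _ _ ≪≫ₗ TensorProduct.piScalarRight R R A ι
  convert e.symm.bijective using 2 with x
  rw [LinearEquiv.eq_symm_apply]
  ext i
  simp [e, Pi.single_apply]

lemma rTensor_mulVecLin_sum_single_tmul {m n : Type*} [Fintype m] [DecidableEq m] [Fintype n]
    [DecidableEq n] (a : Matrix m n R) (y : n → A) :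
    a.mulVecLin.rTensor A (∑ j, Pi.single j 1 ⊗ₜ y j) =
      ∑ i, Pi.single i 1 ⊗ₜ ∑ j, a i j • y j := by
  have hcol (j : n) : a.mulVecLin (Pi.single j 1) = ∑ i, a i j • Pi.single i (1 : R) := by
    ext i
    simp [Pi.single_apply]
  simp only [map_sum, LinearMap.rTensor_tmul, hcol, sum_tmul, tmul_sum, smul_tmul]
  exact Finset.sum_comm

lemma rTensor_mkQ_eq_zero_iff {m n : Type*} [Fintype m] [DecidableEq m] [Fintype n]
    (a : Matrix m n R) (x : m → A) :
    (LinearMap.range a.mulVecLin).mkQ.rTensor A (∑ i, Pi.single i 1 ⊗ₜ x i) = 0 ↔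
      ∃ y : n → A, ∀ i, x i = ∑ j, a i j • y j := by
  classical
  have hexact := rTensor_exact A a.mulVecLin.exact_map_mkQ_range (Submodule.mkQ_surjective _)
  rw [hexact]
  constructor
  · rintro ⟨z, hz⟩
    obtain ⟨y, rfl⟩ := sum_single_tmul_bijective.surjective z
    rw [rTensor_mulVecLin_sum_single_tmul] at hz
    exact ⟨y, fun i => (congrFun (sum_single_tmul_bijective.injective hz) i).symm⟩
  · rintro ⟨y, hy⟩
    refine ⟨∑ j, Pi.single j 1 ⊗ₜ y j, ?_⟩
    simp only [rTensor_mulVecLin_sum_single_tmul, hy]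

lemma IsPureUpTo.exists_smul_eq (hf : IsPureUpTo S f) {m n : Type} [Finite m] [Fintype n]
    (a : Matrix m n R) (x : m → A) (b : n → B) (hb : ∀ i, f (x i) = ∑ j, a i j • b j) :
    ∃ s ∈ S, ∃ y : n → A, ∀ i, s • x i = ∑ j, a i j • y j := by
  classical
  have := Fintype.ofFinite m
  let Q := (m → R) ⧸ LinearMap.range a.mulVecLin
  let t : Q ⊗[R] A := (LinearMap.range a.mulVecLin).mkQ.rTensor A (∑ i, Pi.single i 1 ⊗ₜ x i)
  have ht : f.lTensor Q t = 0 := by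
    rw [← (rTensor_mkQ_eq_zero_iff a (f ∘ x)).2 ⟨b, hb⟩]
    simp [t, Q]
  obtain ⟨s, hs, hst⟩ := hf Q t ht
  refine ⟨s, hs, (rTensor_mkQ_eq_zero_iff a (s • x)).1 ?_⟩
  rw [← hst]
  simp [t, Finset.smul_sum]

lemma IsPureUpTo.exists_extension (hf : IsPureUpTo S f) {n : ℕ} {K : Submodule R (Fin n → R)}
    (hK : K.FG) (u : K →ₗ[R] A) (v : (Fin n → R) →ₗ[R] B) (huv : f ∘ₗ u = v ∘ₗ K.subtype) :
    ∃ s ∈ S, ∃ h : (Fin n → R) →ₗ[R] A, h ∘ₗ K.subtype = s • u := by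
  have : Module.Finite R K := Module.Finite.iff_fg.2 hK
  obtain ⟨m, k, hk⟩ := Module.Finite.exists_fin (R := R) (M := K)
  have hv (z : Fin n → R) : v z = ∑ j, z j • v (Pi.single j 1) := by
    conv_lhs => rw [pi_eq_sum_univ' z]
    simp only [map_sum, map_smul]
  obtain ⟨s, hs, y, hy⟩ := hf.exists_smul_eq (fun i => (k i : Fin n → R)) (u ∘ k) _ fun i =>
    (LinearMap.congr_fun huv (k i)).trans (hv (k i))
  refine ⟨s, hs, Fintype.linearCombination R y, LinearMap.ext_on_range hk fun i => ?_⟩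
  simpa [Fintype.linearCombination_apply] using (hy i).symm

end Purity

section FPInjective

lemma extClass_comp_mk₀_eq_zero_iff {C : Type*} [Category C] [Abelian C] [HasExt C]
    {T : ShortComplex C} (hT : T.ShortExact) {Y : C} (u : T.X₁ ⟶ Y) :
    hT.extClass.comp (Ext.mk₀ u) (add_zero 1) = 0 ↔ ∃ h : T.X₂ ⟶ Y, T.f ≫ h = u := by
  constructor
  · intro h0
    obtain ⟨y, hy⟩ := Ext.contravariant_sequence_exact₁ hT Y (Ext.mk₀ u) (add_zero 1) h0
    obtain ⟨h, rfl⟩ := (Ext.mk₀_bijective T.X₂ Y).surjective y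
    exact ⟨h, (Ext.mk₀_bijective T.X₁ Y).injective (by rw [← Ext.mk₀_comp_mk₀, hy])⟩
  · rintro ⟨h, rfl⟩
    rw [← Ext.mk₀_comp_mk₀, ShortComplex.ShortExact.extClass_comp_assoc]

variable {R : Type u} [CommRing R] {S : Submonoid R}

/-- A module `A` is FP-injective up to `S` if `Ext¹(F, A)` is `S`-torsion for every finitely
presented module `F`; for `S = {1}` these are the FP-injective (absolutely pure) modules. -/
def IsFPInjectiveUpTo (S : Submonoid R) (A : ModuleCat.{u} R) : Prop :=
  ∀ F : ModuleCat.{u} R, Module.FinitePresentation R F → ∀ x : Ext F A 1, ∃ s ∈ S, s • x = 0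

variable {A B : ModuleCat.{u} R}

lemma IsFPInjectiveUpTo.exists_extension (hA : IsFPInjectiveUpTo S A) {n : ℕ}
    {K : Submodule R (Fin n → R)} (hK : K.FG) (u : K →ₗ[R] A) :
    ∃ s ∈ S, ∃ h : (Fin n → R) →ₗ[R] A, h ∘ₗ K.subtype = s • u := by
  let T : ShortComplex (ModuleCat.{u} R) := ModuleCat.shortComplexOfCompEqZero K.subtype K.mkQ
    (LinearMap.exact_subtype_mkQ K).linearMap_comp_eq_zero
  have hT : T.ShortExact := ModuleCat.shortComplex_shortExact T (LinearMap.exact_subtype_mkQ K)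
    K.injective_subtype K.mkQ_surjective
  have hF : Module.FinitePresentation R ((Fin n → R) ⧸ K) :=
    Module.finitePresentation_of_surjective K.mkQ K.mkQ_surjective (by rwa [K.ker_mkQ])
  obtain ⟨s, hs, h0⟩ := hA T.X₃ hF (hT.extClass.comp (Ext.mk₀ (ModuleCat.ofHom u)) (add_zero 1))
  rw [← Ext.comp_smul, ← Ext.mk₀_smul, extClass_comp_mk₀_eq_zero_iff] at h0
  obtain ⟨h, hh⟩ := h0
  exact ⟨s, hs, h.hom, congrArg ModuleCat.Hom.hom hh⟩

lemma IsFPInjectiveUpTo.exists_smul_eq (hA : IsFPInjectiveUpTo S A) {f : A →ₗ[R] B}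
    (hf : Function.Injective f) {m n : ℕ} (a : Fin m → Fin n → R) (x : Fin m → A) (b : Fin n → B)
    (hb : ∀ i, f (x i) = ∑ j, a i j • b j) :
    ∃ s ∈ S, ∃ y : Fin n → A, ∀ i, s • x i = ∑ j, a i j • y j := by
  let K : Submodule R (Fin n → R) := Submodule.span R (Set.range a)
  let v : (Fin n → R) →ₗ[R] B := Fintype.linearCombination R b
  have haK (i : Fin m) : a i ∈ K := Submodule.subset_span ⟨i, rfl⟩
  have hK : K ≤ (LinearMap.range f).comap v := by
    refine Submodule.span_le.2 ?_
    rintro _ ⟨i, rfl⟩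
    exact ⟨x i, hb i⟩
  let u : K →ₗ[R] A :=
    LinearMap.codRestrictOfInjective (v ∘ₗ K.subtype) f hf fun z => hK z.2
  have hu (i : Fin m) : u ⟨a i, haK i⟩ = x i := hf <|
    (LinearMap.codRestrictOfInjective_comp_apply _ f hf _ _).trans (hb i).symm
  obtain ⟨s, hs, h, hh⟩ := hA.exists_extension (Submodule.fg_span (Set.finite_range a)) u
  refine ⟨s, hs, fun j => h (Pi.single j 1), fun i => ?_⟩
  calc s • x i = h (a i) := by rw [← hu i]; exact (LinearMap.congr_fun hh ⟨a i, haK i⟩).symm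
    _ = ∑ j, a i j • h (Pi.single j 1) := by
      conv_lhs => rw [pi_eq_sum_univ' (a i)]
      simp only [map_sum, map_smul]

lemma IsFPInjectiveUpTo.isPureUpTo (hA : IsFPInjectiveUpTo S A) {f : A →ₗ[R] B}
    (hf : Function.Injective f) : IsPureUpTo S f := by
  refine isPureUpTo_of_forall_finite fun N _ _ _ x hx => ?_
  obtain ⟨m, v, hv⟩ := Module.Finite.exists_fin (R := R) (M := N)
  have hr : Function.Surjective (Fintype.linearCombination R v) :=
    LinearMap.range_eq_top.1 ((Fintype.range_linearCombination R v).trans hv)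
  obtain ⟨z, rfl⟩ := LinearMap.rTensor_surjective A hr x
  obtain ⟨q, rfl⟩ := sum_single_tmul_bijective.surjective z
  have hx' : ∑ i, v i ⊗ₜ f (q i) = (0 : N ⊗[R] B) := by simpa using hx
  obtain ⟨n, a, b, hb, hav⟩ := vanishesTrivially_of_sum_tmul_eq_zero R hv hx'
  obtain ⟨s, hs, y, hy⟩ := hA.exists_smul_eq hf a q b hb
  refine ⟨s, hs, ?_⟩
  have := sum_tmul_eq_zero_of_vanishesTrivially R ⟨n, a, y, hy, hav⟩
  simpa [Finset.smul_sum] using this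

lemma IsPureUpTo.isFPInjectiveUpTo {f : A ⟶ B} (hf : IsPureUpTo S f.hom) [Injective B] :
    IsFPInjectiveUpTo S A := by
  intro F hF x
  obtain ⟨n, r, hr⟩ := Module.Finite.exists_fin' R F
  have hT := LinearMap.shortExact_shortComplexKer hr
  have : Projective r.shortComplexKer.X₂ := ModuleCat.projective_of_free (Pi.basisFun R (Fin n))
  have := hT.mono_f
  obtain ⟨x, rfl⟩ := Ext.contravariant_sequence_exact₃ hT A x (Ext.eq_zero_of_projective _)
    (add_zero 1)
  obtain ⟨u, rfl⟩ := (Ext.mk₀_bijective _ _).surjective x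
  have hv := Injective.comp_factorThru (u ≫ f) r.shortComplexKer.f
  obtain ⟨s, hs, h, hh⟩ := hf.exists_extension (Module.FinitePresentation.fg_ker r hr) u.hom
    (Injective.factorThru (u ≫ f) r.shortComplexKer.f).hom (congrArg ModuleCat.Hom.hom hv).symm
  refine ⟨s, hs, ?_⟩
  rw [← Ext.comp_smul, ← Ext.mk₀_smul, extClass_comp_mk₀_eq_zero_iff]
  exact ⟨ModuleCat.ofHom h, ModuleCat.hom_ext hh⟩

lemma IsFPInjectiveUpTo.cosyzygy (hR : IsPseudoCoherent R R) {T : ShortComplex (ModuleCat.{u} R)}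
    (hT : T.ShortExact) [Injective T.X₂] (h₁ : IsFPInjectiveUpTo S T.X₁) :
    IsFPInjectiveUpTo S T.X₃ := by
  intro F hF x
  obtain ⟨n, r, hr⟩ := Module.Finite.exists_fin' R F
  have hP := LinearMap.shortExact_shortComplexKer hr
  have : Projective r.shortComplexKer.X₂ := ModuleCat.projective_of_free (Pi.basisFun R (Fin n))
  have hK : Module.FinitePresentation R (LinearMap.ker r) :=
    hR.fin_pi n _ (Module.FinitePresentation.fg_ker r hr)
  obtain ⟨y, hy⟩ := Ext.contravariant_sequence_exact₃ hP T.X₁ (x.comp hT.extClass rfl)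
    (Ext.eq_zero_of_projective _) (n₀ := 1) rfl
  obtain ⟨s, hs, hsy⟩ := h₁ _ hK y
  have hsx : (s • x).comp hT.extClass rfl = 0 := by
    rw [Ext.smul_comp, ← hy, ← Ext.comp_smul, hsy, Ext.comp_zero]
  obtain ⟨z, hz⟩ := Ext.covariant_sequence_exact₃ F hT (s • x) rfl hsx
  exact ⟨s, hs, by rw [← hz, Ext.eq_zero_of_injective z, Ext.zero_comp]⟩

end FPInjective

section AbsolutelyWPure

variable {R : Type u} [CommRing R]

lemma isPureUpTo_iff_injective_map_rTensor {A B : Type u} [AddCommGroup A] [Module R A]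
    [AddCommGroup B] [Module R B] {S : Submonoid R} {f : A →ₗ[R] B} :
    IsPureUpTo S f ↔ ∀ (N : Type u) [AddCommGroup N] [Module R N],
      Function.Injective (LocalizedModule.map S (f.rTensor N)) := by
  refine forall_congr' fun N => forall₂_congr fun _ _ => ?_
  rw [localizedModule_map_injective_iff, (TensorProduct.comm R A N).surjective.forall]
  refine forall_congr' fun x => imp_congr ?_ (exists_congr fun s => and_congr_right fun _ => ?_)
  · rw [← LinearMap.comm_comp_rTensor_comp_comm_eq]
    simp
  · rw [← LinearEquiv.map_smul, LinearEquiv.map_eq_zero_iff]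

lemma isAbsolutelyWPure_iff_isPureUpTo {A : Type u} [AddCommGroup A] [Module R A] :
    IsAbsolutelyWPure R A ↔ ∀ (B : Type u) [AddCommGroup B] [Module R B] (f : A →ₗ[R] B),
      Function.Injective f → ∀ (p : Ideal R) [p.IsPrime], IsMaximalWIdeal p →
        IsPureUpTo p.primeCompl f := by
  simp only [isPureUpTo_iff_injective_map_rTensor]
  refine ⟨fun hA B _ _ f hf p _ hp N _ _ => ((hA B f hf).2 N p hp).1, fun h B _ _ f hf => ?_⟩
  have hex : Function.Exact f (LinearMap.range f).mkQ := f.exact_map_mkQ_range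
  have hsurj := (LinearMap.range f).mkQ_surjective
  exact ⟨fun p _ _ => ⟨IsLocalizedModule.map_injective p.primeCompl _ _ f hf,
      LocalizedModule.map_exact _ _ _ hex,
      IsLocalizedModule.map_surjective p.primeCompl _ _ _ hsurj⟩,
    fun N _ _ p _ hp => ⟨h B f hf p hp N,
      LocalizedModule.map_exact _ _ _ (rTensor_exact N hex hsurj),
      IsLocalizedModule.map_surjective p.primeCompl _ _ _ (LinearMap.rTensor_surjective N hsurj)⟩⟩

lemma isAbsolutelyWPure_iff_isFPInjectiveUpTo {A : ModuleCat.{u} R} :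
    IsAbsolutelyWPure R A ↔ ∀ (p : Ideal R) [p.IsPrime], IsMaximalWIdeal p →
      IsFPInjectiveUpTo p.primeCompl A := by
  rw [isAbsolutelyWPure_iff_isPureUpTo]
  constructor
  · intro hA p _ hp
    exact (hA (Injective.under (C := ModuleCat.{u} R) A) (Injective.ι A).hom
      ((ModuleCat.mono_iff_injective _).1 inferInstance) p hp).isFPInjectiveUpTo
  · intro hA B _ _ f hf p _ hp
    exact (hA p hp).isPureUpTo (B := ModuleCat.of R B) hf

end AbsolutelyWPure

section RelativeDimension

variable {C : Type*} [Category C] [Abelian C] [HasExt C]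

/-- `Ext^i(X, A) = 0` for all `A` in the class `𝒜`. -/
def ExtVanishesOn (𝒜 : ObjectProperty C) (X : C) (i : ℕ) : Prop :=
  ∀ A, 𝒜 A → Subsingleton (Ext X A i)

/-- A class of objects is closed under cosyzygies if it contains the cokernel of every
monomorphism from one of its members to an injective object. -/
def IsClosedUnderCosyzygies (𝒜 : ObjectProperty C) : Prop :=
  ∀ T : ShortComplex C, T.ShortExact → Injective T.X₂ → 𝒜 T.X₁ → 𝒜 T.X₃

variable {𝒜 : ObjectProperty C} {X Y : C} {i j : ℕ}

lemma ExtVanishesOn.of_iso (e : X ≅ Y) (hX : ExtVanishesOn 𝒜 X i) : ExtVanishesOn 𝒜 Y i := by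
  intro A hA
  have := hX A hA
  refine subsingleton_of_forall_eq 0 fun x => ?_
  rw [← Ext.mk₀_id_comp x, ← e.inv_hom_id, ← Ext.mk₀_comp_mk₀_assoc,
    Subsingleton.elim ((Ext.mk₀ e.hom).comp x (zero_add i)) 0, Ext.comp_zero]

lemma ExtVanishesOn.of_projective [Projective X] : ExtVanishesOn 𝒜 X (i + 1) :=
  fun A _ => Ext.subsingleton_of_projective X A i

lemma ExtVanishesOn.succ [EnoughInjectives C] (h𝒜 : IsClosedUnderCosyzygies 𝒜)
    (hX : ExtVanishesOn 𝒜 X i) : ExtVanishesOn 𝒜 X (i + 1) := by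
  intro A hA
  let I := (EnoughInjectives.presentation A).some
  have hI := I.shortExact_shortComplex
  have := hX _ (h𝒜 I.shortComplex hI inferInstance hA)
  refine subsingleton_of_forall_eq 0 fun x => ?_
  obtain ⟨y, rfl⟩ := Ext.covariant_sequence_exact₁ X hI x (Ext.eq_zero_of_injective _) rfl
  rw [Subsingleton.elim y 0, Ext.zero_comp]

lemma ExtVanishesOn.mono [EnoughInjectives C] (h𝒜 : IsClosedUnderCosyzygies 𝒜) (hij : i ≤ j)
    (hX : ExtVanishesOn 𝒜 X i) : ExtVanishesOn 𝒜 X j :=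
  Nat.le_induction hX (fun _ _ => .succ h𝒜) j hij

lemma extVanishesOn_succ_iff_of_shortExact {T : ShortComplex C} (hT : T.ShortExact)
    (h₂ : ExtVanishesOn 𝒜 T.X₂ i) (h₂' : ExtVanishesOn 𝒜 T.X₂ (i + 1)) :
    ExtVanishesOn 𝒜 T.X₃ (i + 1) ↔ ExtVanishesOn 𝒜 T.X₁ i := by
  refine forall₂_congr fun A hA => ?_
  have := h₂ A hA
  have := h₂' A hA
  constructor <;> refine fun _ => subsingleton_of_forall_eq 0 fun x => ?_
  · obtain ⟨y, rfl⟩ := Ext.contravariant_sequence_exact₁ hT A x (add_comm 1 i)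
      (Subsingleton.elim _ _)
    rw [Subsingleton.elim y 0, Ext.comp_zero]
  · obtain ⟨y, rfl⟩ := Ext.contravariant_sequence_exact₃ hT A x (Subsingleton.elim _ _)
      (add_comm 1 i)
    rw [Subsingleton.elim y 0, Ext.comp_zero]

end RelativeDimension
section WFPDimension

variable {R M : Type u} [CommRing R] [AddCommGroup M] [Module R M] {n : ℕ}

/-- The class of absolutely `w`-pure modules, relative to which `w`-FP-projectivity and the
`w`-FP-projective dimension are defined. -/
def absolutelyWPure (R : Type u) [CommRing R] : ObjectProperty (ModuleCat.{u} R) :=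
  fun A => IsAbsolutelyWPure R A

lemma isClosedUnderCosyzygies_absolutelyWPure (hR : IsCoherentRing R) :
    IsClosedUnderCosyzygies (absolutelyWPure R) := fun _ hT _ h₁ =>
  isAbsolutelyWPure_iff_isFPInjectiveUpTo.2 fun p _ hp =>
    (isAbsolutelyWPure_iff_isFPInjectiveUpTo.1 h₁ p hp).cosyzygy hR hT

lemma extVanishesOn_absolutelyWPure_iff {i : ℕ} :
    ExtVanishesOn (absolutelyWPure R) (ModuleCat.of R M) i ↔
      ∀ (A : Type u) [AddCommGroup A] [Module R A], IsAbsolutelyWPure R A → ExtVanishes R M A i :=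
  ⟨fun h A _ _ hA => h (ModuleCat.of R A) hA, fun h A hA => h A hA⟩

lemma isWFPProjective_iff :
    IsWFPProjective R M ↔ ExtVanishesOn (absolutelyWPure R) (ModuleCat.of R M) 1 :=
  extVanishesOn_absolutelyWPure_iff.symm

lemma isWFPProjective_of_projective (_ : Module.Projective R M) : IsWFPProjective R M :=
  isWFPProjective_iff.2 .of_projective

lemma wfpd_le_iff (hR : IsCoherentRing R) :
    wfpd R M ≤ n ↔ ExtVanishesOn (absolutelyWPure R) (ModuleCat.of R M) (n + 1) := by
  simp only [wfpd, ← extVanishesOn_absolutelyWPure_iff]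
  refine ⟨fun h => ?_, fun h => sInf_le ⟨n, h, rfl⟩⟩
  obtain ⟨_, ⟨k, hk, rfl⟩, hkn⟩ := sInf_lt_iff.1 (h.trans_lt ENat.natCast_lt_succ)
  have hkn : k ≤ n := Nat.le_of_lt_succ (Nat.cast_lt (α := ℕ∞).1 hkn)
  exact hk.mono (isClosedUnderCosyzygies_absolutelyWPure hR) (Nat.succ_le_succ hkn)

namespace ExactSeq

/-- The exact sequence `0 → P_{n+1} → ⋯ → P_1 → ker ε → 0` obtained from
`0 → P_{n+1} → ⋯ → P_0 → M → 0`. -/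
def tail (S : ExactSeq R M (n + 1)) : ExactSeq R (LinearMap.ker S.ε) n where
  P i := S.P (i + 1)
  d i := S.d (i + 1)
  ε := (S.d 0).codRestrict _ S.exact_zero.apply_apply_eq_zero
  surjective x := by
    obtain ⟨y, hy⟩ := (S.exact_zero x).1 x.2
    exact ⟨y, Subtype.ext hy⟩
  exact_zero x := by
    rw [← S.exact_succ 0 x]
    exact Subtype.ext_iff
  exact_succ i := S.exact_succ (i + 1)
  subsingleton i hi := S.subsingleton (i + 1) (Nat.succ_lt_succ hi)

/-- The Yoneda splice of an exact sequence `0 → P_n → ⋯ → P_0 → ker π → 0` with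
`0 → ker π → P → M → 0`. -/
def cons (P : ModuleCat.{u} R) (π : P →ₗ[R] M) (hπ : Function.Surjective π)
    (S : ExactSeq R (LinearMap.ker π) n) : ExactSeq R M (n + 1) where
  P
    | 0 => P
    | i + 1 => S.P i
  d
    | 0 => (LinearMap.ker π).subtype ∘ₗ S.ε
    | i + 1 => S.d i
  ε := π
  surjective := hπ
  exact_zero := by
    rw [LinearMap.exact_iff, LinearMap.range_comp, LinearMap.range_eq_top.2 S.surjective,
      Submodule.map_top, Submodule.range_subtype]
  exact_succ
    | 0 => S.exact_zero.comp_injective _ (LinearMap.ker π).injective_subtype (map_zero _)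
    | i + 1 => S.exact_succ i
  subsingleton
    | i + 1, h => S.subsingleton i (Nat.lt_of_succ_lt_succ h)

/-- The exact sequence `0 → M → M → 0`. -/
def self (R M : Type u) [CommRing R] [AddCommGroup M] [Module R M] : ExactSeq R M 0 where
  P
    | 0 => ModuleCat.of R M
    | _ + 1 => ModuleCat.of R PUnit
  d _ := 0
  ε := LinearMap.id
  surjective := Function.surjective_id
  exact_zero _ := ⟨fun hx => ⟨0, hx.symm⟩, fun ⟨_, hy⟩ => hy.symm⟩
  exact_succ _ _ := ⟨fun _ => ⟨0, Subsingleton.elim (α := PUnit) _ _⟩, fun _ => rfl⟩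
  subsingleton
    | _ + 1, _ => inferInstanceAs (Subsingleton PUnit)

lemma exists_projective (n : ℕ) (M : Type u) [AddCommGroup M] [Module R M] :
    ∃ S : ExactSeq R M n, ∀ i < n, Module.Projective R (S.P i) := by
  induction n generalizing M with
  | zero => exact ⟨self R M, fun i hi => absurd hi i.not_lt_zero⟩
  | succ n ih =>
    let π : (M →₀ R) →ₗ[R] M := Finsupp.linearCombination R id
    obtain ⟨S, hS⟩ := ih (LinearMap.ker π)
    refine ⟨cons (.of R (M →₀ R)) π (Finsupp.linearCombination_id_surjective R M) S, fun
      | 0, _ => inferInstanceAs (Module.Projective R (M →₀ R))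
      | i + 1, hi => hS i (Nat.lt_of_succ_lt_succ hi)⟩

lemma bijective_ε (S : ExactSeq R M 0) : Function.Bijective S.ε := by
  have := S.subsingleton 1 zero_lt_one
  refine ⟨(injective_iff_map_eq_zero S.ε).2 fun x hx => ?_, S.surjective⟩
  obtain ⟨y, rfl⟩ := (S.exact_zero x).1 hx
  rw [Subsingleton.elim y 0, map_zero]

lemma extVanishesOn_succ_iff {𝒜 : ObjectProperty (ModuleCat.{u} R)}
    (h𝒜 : IsClosedUnderCosyzygies 𝒜) (S : ExactSeq R M n)
    (hS : ∀ i < n, ExtVanishesOn 𝒜 (S.P i) 1) :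
    ExtVanishesOn 𝒜 (ModuleCat.of R M) (n + 1) ↔ ExtVanishesOn 𝒜 (S.P n) 1 := by
  induction n generalizing M with
  | zero =>
    let e : S.P 0 ≅ ModuleCat.of R M := (LinearEquiv.ofBijective S.ε S.bijective_ε).toModuleIso
    exact ⟨.of_iso e.symm, .of_iso e⟩
  | succ n ih =>
    have h₀ (j : ℕ) : ExtVanishesOn 𝒜 (S.P 0) (j + 1) :=
      (hS 0 n.succ_pos).mono h𝒜 (Nat.le_add_left 1 j)
    calc ExtVanishesOn 𝒜 (ModuleCat.of R M) (n + 1 + 1)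
        ↔ ExtVanishesOn 𝒜 (ModuleCat.of R (LinearMap.ker S.ε)) (n + 1) :=
          extVanishesOn_succ_iff_of_shortExact (LinearMap.shortExact_shortComplexKer S.surjective)
            (h₀ n) (h₀ (n + 1))
      _ ↔ ExtVanishesOn 𝒜 (S.P (n + 1)) 1 :=
          ih S.tail fun i hi => hS (i + 1) (Nat.succ_lt_succ hi)

end ExactSeq

lemma isWFPProjective_last_iff (hR : IsCoherentRing R) (S : ExactSeq R M n)
    (hS : ∀ i < n, IsWFPProjective R (S.P i)) :
    IsWFPProjective R (S.P n) ↔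
      ExtVanishesOn (absolutelyWPure R) (ModuleCat.of R M) (n + 1) := by
  simp only [isWFPProjective_iff] at hS ⊢
  exact (S.extVanishesOn_succ_iff (isClosedUnderCosyzygies_absolutelyWPure hR) hS).symm

end WFPDimension

end WFPProj

theorem mainTheorem7 {R : Type u} [CommRing R] (hR : WFPProj.IsCoherentRing R)
    (M : Type u) [AddCommGroup M] [Module R M] (n : ℕ) :
    List.TFAE [
      WFPProj.wfpd R M ≤ (n : ℕ∞),
      ∀ (A : Type u) [AddCommGroup A] [Module R A], WFPProj.IsAbsolutelyWPure R A →
        WFPProj.ExtVanishes R M A (n + 1),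
      ∀ (A : Type u) [AddCommGroup A] [Module R A], WFPProj.IsAbsolutelyWPure R A →
        ∀ j : ℕ, 1 ≤ j → WFPProj.ExtVanishes R M A (n + j),
      ∀ S : WFPProj.ExactSeq R M n, (∀ i < n, WFPProj.IsWFPProjective R (S.P i)) →
        WFPProj.IsWFPProjective R (S.P n),
      ∀ S : WFPProj.ExactSeq R M n, (∀ i < n, Module.Projective R (S.P i)) →
        WFPProj.IsWFPProjective R (S.P n),
      ∃ S : WFPProj.ExactSeq R M n, ∀ i ≤ n, WFPProj.IsWFPProjective R (S.P i)] := by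
  have hcosyz := WFPProj.isClosedUnderCosyzygies_absolutelyWPure hR
  rw [← WFPProj.extVanishesOn_absolutelyWPure_iff]
  tfae_have 1 ↔ 2 := WFPProj.wfpd_le_iff hR
  tfae_have 2 → 3 := fun h A _ _ hA j hj =>
    WFPProj.extVanishesOn_absolutelyWPure_iff.1 (h.mono hcosyz (Nat.add_le_add_left hj n)) A hA
  tfae_have 3 → 2 := fun h A hA => h A hA 1 le_rfl
  tfae_have 2 → 4 := fun h S hS => (WFPProj.isWFPProjective_last_iff hR S hS).2 h
  tfae_have 4 → 5 := fun h S hS => h S fun i hi =>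
    WFPProj.isWFPProjective_of_projective (hS i hi)
  tfae_have 5 → 6 := fun h => by
    obtain ⟨S, hS⟩ := WFPProj.ExactSeq.exists_projective (R := R) n M
    exact ⟨S, fun i hi => hi.lt_or_eq.elim
      (fun hi => WFPProj.isWFPProjective_of_projective (hS i hi)) fun hi => hi ▸ h S hS⟩
  tfae_have 6 → 2 := fun ⟨S, hS⟩ =>
    (WFPProj.isWFPProjective_last_iff hR S fun i hi => hS i hi.le).1 (hS n le_rfl)
  tfae_finish
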